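/- Let $q\ge 2$, $n\ge 1$, $m\ge 0$ be integers, let $M,K\in\mathbb{R}^{n\times n}$ be symmetric positive definite, and suppose that the roots of the polynomial $s\mapsto\det(sM-K)$ are distinct. Let $C_d\in\mathbb{R}^{m\times n}$, and let $d_{ij}\ge 0$ $(i,j=1,\dots,q)$ be real numbers with $d_{ij}=d_{ji}$ and $d_{ii}=0$. Consider the array of $q$ coupled oscillators $$M\ddot x_i+Kx_i+\sum_{j=1}^{q}d_{ij}C_d^{T}C_d(\dot x_i-\dot x_j)=0,\qquad i=1,\dots,q,\qquad x_i(t)\in\mathbb{R}^n,\ t\ge 0.$$ The array is said to synchronize if every solution satisfies $\|x_i(t)-x_j(t)\|\to 0$ as $t\to\infty$ for all $i,j$. Let $\ell_d\in\mathbb{R}^{q\times q}$ be the Laplacian matrix with entries $(\ell_d)_{ii}=\sum_{j}d_{ij}$ and $(\ell_d)_{ij}=-d_{ij}$ for $i\ne j$, and let $\lambda_2(\ell_d)$ be its second smallest eigenvalue, counted with multiplicity. Then the array synchronizes if and only if $\lambda_2(\ell_d)>0$ and the pair $(C_d,M^{-1}K)$ is observable, i.e., for the system $\dot x=M^{-1}Kx$,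 $y=C_dx$, the output $y(t)$, $t\ge 0$, determines the initial state $x(0)$. -/

import Mathlib

open scoped Matrix

/-- The Laplacian matrix `lap (w i j)` of a family of scalar weights. -/
def lap {q : ℕ} (w : Fin q → Fin q → ℝ) : Matrix (Fin q) (Fin q) ℝ :=
  Matrix.of fun i j => if i = j then ∑ k, w i k else -w i j

/-- The real part of `λ_k(X)`, the `k`-th smallest eigenvalue (`1 ≤ k ≤ n`) of the complex matrix
`X` with respect to the real part: the roots of the characteristic polynomial, counted with
multiplicity, are ordered by increasing real part. (The value for `k = 0` or `k > n` is
meaningless.) -/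
noncomputable def reEigenvalue {n : ℕ} (X : Matrix (Fin n) (Fin n) ℂ) (k : ℕ) : ℝ :=
  ((X.charpoly.roots.map Complex.re).sort (· ≤ ·)).getD (k - 1) 0

/-- The polynomial `det (s M - K)` in the indeterminate `s`. -/
noncomputable def pencilPoly {n : ℕ} (M K : Matrix (Fin n) (Fin n) ℝ) : Polynomial ℝ :=
  ((Polynomial.X : Polynomial ℝ) • M.map Polynomial.C - K.map Polynomial.C).det

/-- `x` is a trajectory of the linear system `x' = A x` on `[0, ∞)`. -/
def IsLinearTrajectory {n : ℕ} (A : Matrix (Fin n) (Fin n) ℝ) (x : ℝ → Fin n → ℝ) : Prop :=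
  ∀ t : ℝ, 0 ≤ t → HasDerivWithinAt x (A *ᵥ x t) (Set.Ici 0) t

/-- Observability of the pair `(C, A)`: for the system `x' = A x`, `y = C x`, the output on
`[0, ∞)` determines the initial state. -/
def IsObservable {m n : ℕ} (C : Matrix (Fin m) (Fin n) ℝ) (A : Matrix (Fin n) (Fin n) ℝ) : Prop :=
  ∀ x₁ x₂ : ℝ → Fin n → ℝ, IsLinearTrajectory A x₁ → IsLinearTrajectory A x₂ →
    (∀ t : ℝ, 0 ≤ t → C *ᵥ x₁ t = C *ᵥ x₂ t) → x₁ 0 = x₂ 0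

/-- `x` (with `x t i` the position of the `i`-th oscillator at time `t`) solves, on `[0, ∞)`,
the purely dissipatively coupled array
`M xᵢ'' + K xᵢ + ∑ⱼ Dᵢⱼ (xᵢ' - xⱼ') = 0`, `i = 1, …, q`. -/
def IsArraySolution {q n : ℕ} (M K : Matrix (Fin n) (Fin n) ℝ)
    (D : Fin q → Fin q → Matrix (Fin n) (Fin n) ℝ) (x : ℝ → Fin q → Fin n → ℝ) : Prop :=
  ∃ v a : ℝ → Fin q → Fin n → ℝ,
    ∀ t : ℝ, 0 ≤ t →
      HasDerivWithinAt x (v t) (Set.Ici 0) t ∧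
      HasDerivWithinAt v (a t) (Set.Ici 0) t ∧
      ∀ i, M *ᵥ a t i + K *ᵥ x t i + ∑ j, D i j *ᵥ (v t i - v t j) = 0

/-- The array synchronizes: `‖xᵢ(t) - xⱼ(t)‖ → 0` (Euclidean norm) as `t → ∞`, for all indices
`i, j` and all solutions, i.e. all initial conditions. -/
def Synchronizes {q n : ℕ} (M K : Matrix (Fin n) (Fin n) ℝ)
    (D : Fin q → Fin q → Matrix (Fin n) (Fin n) ℝ) : Prop :=
  ∀ x : ℝ → Fin q → Fin n → ℝ, IsArraySolution M K D x →
    ∀ i j, Filter.Tendsto (fun t => ‖WithLp.toLp 2 (x t i - x t j)‖) Filter.atTop (nhds 0)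

/-! Sufficiency is a LaSalle argument. The energy `arrayEnergy` decreases at the rate
`arrayDissipation`, a weighted sum of squared differences of the outputs `C ẋᵢ`. By
`IsFieldTrajectory.tendsto_zero_of_lyapunov` it is enough to study trajectories of constant energy.
On these the dissipation vanishes, so each coordinate of the outputs lies in the kernel of the
Laplacian, which consists of constants when `λ₂ > 0`. The coupling force is then zero and the
oscillators run freely. The difference of two velocities stays invisible to `C`, so repeated
differentiation puts it in the unobservable subspace, which is zero. The difference of positions is
then killed by the invertible `M⁻¹ K`, hence is zero as well.

Necessity is shown by undamped modes. The operator `M⁻¹ K` is self-adjoint for the inner product of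
`M` and positive, so every nonzero invariant subspace contains an eigenvector `u` with eigenvalue `μ
> 0` (`exists_pencil_eigenvector`). If the coupling does not see the motion `xᵢ(t) = cos(√μ t) zᵢ
u`, this is a periodic solution, and synchronization forces `z` to be constant
(`Synchronizes.eq_of_mode`). The motion is unseen when `z` is in the kernel of the Laplacian, for
any `u`, and when `C u = 0`, for any `z`. -/

/-! ### Eigenvectors of the pencil in invariant subspaces -/

/-- A symmetric operator with a nonzero invariant subspace has an eigenvector in that subspace. -/
lemma exists_eigenvector_mem_of_symmetric {V : Type*} [AddCommGroup V] [Module ℝ V]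
    [FiniteDimensional ℝ V] (c : InnerProductSpace.Core ℝ V) (T : V →ₗ[ℝ] V)
    (hT : ∀ x y, c.inner (T x) y = c.inner x (T y)) (N : Submodule ℝ V) (hN : N ≠ ⊥)
    (hTN : ∀ v ∈ N, T v ∈ N) : ∃ u ∈ N, u ≠ 0 ∧ ∃ μ : ℝ, T u = μ • u := by
  let _ : NormedAddCommGroup V := c.toNormedAddCommGroup
  let _ : InnerProductSpace ℝ V := InnerProductSpace.ofCore c.toCore
  have hS : T.IsSymmetric := hT
  have hS' := hS.restrict_invariant hTN
  by_contra! h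
  refine hN ((Submodule.subsingleton_iff_eq_bot).1
    (hS'.subsingleton_of_no_eigenvalue_finiteDimensional fun μ => ?_))
  rw [Submodule.eq_bot_iff]
  intro x hx
  rw [Module.End.mem_eigenspace_iff] at hx
  by_contra hx0
  exact h x x.2 (by simpa using hx0) μ (by simpa using congrArg Subtype.val hx)

/-- The inner product defined by a positive definite real matrix. -/
noncomputable abbrev Matrix.PosDef.innerCore {n : ℕ} {M : Matrix (Fin n) (Fin n) ℝ} (hM : M.PosDef) :
    InnerProductSpace.Core ℝ (Fin n → ℝ) where
  inner x y := x ⬝ᵥ M *ᵥ y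
  conj_inner_symm x y := by
    have h : Mᵀ = M := by simpa using hM.isHermitian.eq
    simp only [conj_trivial]
    rw [dotProduct_comm, ← Matrix.vecMul_transpose, h, Matrix.dotProduct_mulVec]
  re_inner_nonneg x := by simpa using hM.posSemidef.dotProduct_mulVec_nonneg x
  add_left x y z := by simp [add_dotProduct]
  smul_left x y r := by simp
  definite x hx := by
    by_contra h
    have := hM.dotProduct_mulVec_pos h
    simp only [star_trivial] at this
    exact this.ne' hx

lemma Matrix.PosDef.mul_inv_mulVec {n : ℕ} {M K : Matrix (Fin n) (Fin n) ℝ} (hM : M.PosDef)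
    (y : Fin n → ℝ) : M *ᵥ ((M⁻¹ * K) *ᵥ y) = K *ᵥ y := by
  have hu : IsUnit M.det := hM.det_pos.ne'.isUnit
  rw [Matrix.mulVec_mulVec, ← Matrix.mul_assoc, Matrix.mul_nonsing_inv _ hu, Matrix.one_mul]

/-- A nonzero subspace invariant under `M⁻¹ K` contains an eigenvector with positive eigenvalue. -/
lemma exists_pencil_eigenvector {n : ℕ} {M K : Matrix (Fin n) (Fin n) ℝ} (hM : M.PosDef)
    (hK : K.PosDef) (N : Submodule ℝ (Fin n → ℝ)) (hN : N ≠ ⊥)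
    (hinv : ∀ v ∈ N, (M⁻¹ * K) *ᵥ v ∈ N) :
    ∃ u ∈ N, u ≠ 0 ∧ ∃ μ : ℝ, 0 < μ ∧ (M⁻¹ * K) *ᵥ u = μ • u := by
  obtain ⟨u, huN, hu0, μ, hμ⟩ := exists_eigenvector_mem_of_symmetric hM.innerCore
    (Matrix.mulVecLin (M⁻¹ * K)) (fun x y => by
      -- Both sides reduce to the symmetric form of `K`, since `M (M⁻¹ K) = K`.
      have hMs : Mᵀ = M := by simpa using hM.isHermitian.eq
      have hKs : Kᵀ = K := by simpa using hK.isHermitian.eq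
      change ((M⁻¹ * K) *ᵥ x) ⬝ᵥ M *ᵥ y = x ⬝ᵥ M *ᵥ ((M⁻¹ * K) *ᵥ y)
      rw [hM.mul_inv_mulVec, Matrix.dotProduct_mulVec, ← Matrix.mulVec_transpose, hMs,
        hM.mul_inv_mulVec, Matrix.dotProduct_mulVec, ← Matrix.mulVec_transpose, hKs]) N hN hinv
  refine ⟨u, huN, hu0, μ, ?_, hμ⟩
  have h1 : K *ᵥ u = μ • M *ᵥ u := by
    rw [← hM.mul_inv_mulVec (K := K), show (M⁻¹ * K) *ᵥ u = μ • u from hμ, Matrix.mulVec_smul]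
  have h2 := hK.dotProduct_mulVec_pos hu0
  have h3 := hM.dotProduct_mulVec_pos hu0
  simp only [star_trivial] at h2 h3
  rw [h1, dotProduct_smul, smul_eq_mul] at h2
  exact pos_of_mul_pos_left h2 h3.le

/-! ### Observability and the unobservable subspace -/

/-- The unobservable subspace of the pair `(C, A)`. -/
def unobservableSubspace {m n : ℕ} (C : Matrix (Fin m) (Fin n) ℝ) (A : Matrix (Fin n) (Fin n) ℝ) :
    Submodule ℝ (Fin n → ℝ) where
  carrier := {u | ∀ k : ℕ, (C * A ^ k) *ᵥ u = 0}
  add_mem' ha hb k := by rw [Matrix.mulVec_add, ha k, hb k, add_zero]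
  zero_mem' k := Matrix.mulVec_zero _
  smul_mem' c x hx k := by rw [Matrix.mulVec_smul, hx k, smul_zero]

lemma mulVec_mem_unobservableSubspace {m n : ℕ} {C : Matrix (Fin m) (Fin n) ℝ}
    {A : Matrix (Fin n) (Fin n) ℝ} {u : Fin n → ℝ} (hu : u ∈ unobservableSubspace C A) :
    A *ᵥ u ∈ unobservableSubspace C A := fun k => by
  rw [Matrix.mulVec_mulVec, Matrix.mul_assoc, ← pow_succ]
  exact hu (k + 1)

lemma HasDerivWithinAt.matrix_mulVec {m n : ℕ} (B : Matrix (Fin m) (Fin n) ℝ) {f : ℝ → Fin n → ℝ}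
    {f' : Fin n → ℝ} {s : Set ℝ} {t : ℝ} (h : HasDerivWithinAt f f' s t) :
    HasDerivWithinAt (fun t => B *ᵥ f t) (B *ᵥ f') s t :=
  (LinearMap.toContinuousLinearMap (Matrix.mulVecLin B)).hasFDerivAt.comp_hasDerivWithinAt t h

/-- If `f` vanishes on `[0, ∞)` then so does its one-sided derivative. -/
lemma HasDerivWithinAt.eq_zero_of_eqOn_Ici {F : Type*} [NormedAddCommGroup F] [NormedSpace ℝ F]
    {f : ℝ → F} {f' : F} {t : ℝ} (ht : 0 ≤ t) (h : HasDerivWithinAt f f' (Set.Ici 0) t)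
    (hf : ∀ s, 0 ≤ s → f s = 0) : f' = 0 := by
  refine (uniqueDiffOn_Ici (0 : ℝ) t ht).eq_deriv _ h ?_
  exact (hasDerivWithinAt_const t (Set.Ici (0 : ℝ)) (0 : F)).congr (fun s hs => hf s hs) (hf t ht)

/-- If `C A ^ k` annihilates the difference of two trajectories at all times, differentiation shows
that `C A ^ (k + 1)` does too. -/
lemma isObservable_of_unobservableSubspace_eq_bot {m n : ℕ} {C : Matrix (Fin m) (Fin n) ℝ}
    {A : Matrix (Fin n) (Fin n) ℝ} (h : unobservableSubspace C A = ⊥) : IsObservable C A := by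
  intro x₁ x₂ h₁ h₂ hC
  have key : ∀ k : ℕ, ∀ t : ℝ, 0 ≤ t → (C * A ^ k) *ᵥ (x₁ t - x₂ t) = 0 := by
    intro k
    induction k with
    | zero =>
      intro t ht
      rw [pow_zero, Matrix.mul_one, Matrix.mulVec_sub, hC t ht, sub_self]
    | succ k ih =>
      intro t ht
      have hd := (((h₁ t ht).sub (h₂ t ht)).matrix_mulVec (C * A ^ k)).eq_zero_of_eqOn_Ici ht ih
      rwa [← Matrix.mulVec_sub, Matrix.mulVec_mulVec, Matrix.mul_assoc, ← pow_succ] at hd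
  have hmem : x₁ 0 - x₂ 0 ∈ unobservableSubspace C A := fun k => key k 0 le_rfl
  rw [h, Submodule.mem_bot] at hmem
  exact sub_eq_zero.1 hmem

/-- An eigenvector of `A` in the kernel of `C` obstructs observability. -/
lemma IsObservable.mulVec_ne_zero {m n : ℕ} {C : Matrix (Fin m) (Fin n) ℝ}
    {A : Matrix (Fin n) (Fin n) ℝ} (h : IsObservable C A) {u : Fin n → ℝ} (hu : u ≠ 0) {μ : ℝ}
    (hμ : A *ᵥ u = μ • u) : C *ᵥ u ≠ 0 := by
  intro hC
  refine hu ?_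
  have := h (fun t => Real.exp (μ * t) • u) (fun _ => 0) ?_ ?_ ?_
  · simpa using this
  · intro t _
    have h1 : HasDerivAt (fun t : ℝ => Real.exp (μ * t)) (Real.exp (μ * t) * μ) t := by
      simpa using ((hasDerivAt_id t).const_mul μ).exp
    have h2 := (h1.smul_const u).hasDerivWithinAt (s := Set.Ici 0)
    rwa [mul_smul, ← hμ, ← Matrix.mulVec_smul] at h2
  · intro t _
    simpa using hasDerivWithinAt_const t (Set.Ici (0 : ℝ)) (0 : Fin n → ℝ)
  · intro t _
    simp [Matrix.mulVec_smul, hC]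

/-- A nonzero unobservable subspace would contain a real eigenvector, so a single exponential
trajectory with zero output contradicts observability. -/
lemma IsObservable.unobservableSubspace_eq_bot {m n : ℕ} {M K : Matrix (Fin n) (Fin n) ℝ}
    (hM : M.PosDef) (hK : K.PosDef) {C : Matrix (Fin m) (Fin n) ℝ}
    (h : IsObservable C (M⁻¹ * K)) : unobservableSubspace C (M⁻¹ * K) = ⊥ := by
  by_contra hN
  obtain ⟨u, huN, hu0, μ, -, hμ⟩ :=
    exists_pencil_eigenvector hM hK _ hN fun v hv => mulVec_mem_unobservableSubspace hv
  exact h.mulVec_ne_zero hu0 hμ (by simpa using huN 0)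

/-! ### The Laplacian and its second eigenvalue -/

lemma lap_mulVec_apply {q : ℕ} {d : Fin q → Fin q → ℝ} (hd : ∀ i, d i i = 0) (z : Fin q → ℝ)
    (i : Fin q) : (lap d *ᵥ z) i = ∑ j, d i j * (z i - z j) := by
  have h : ∀ j, lap d i j * z j = (if i = j then (∑ k, d i k) * z i else 0) - d i j * z j := by
    intro j
    by_cases hij : i = j
    · subst hij; simp [lap, hd]
    · simp [lap, hij]
  rw [Matrix.mulVec, dotProduct, Finset.sum_congr rfl fun j _ => h j, Finset.sum_sub_distrib,
    Finset.sum_ite_eq, if_pos (Finset.mem_univ i), Finset.sum_mul, ← Finset.sum_sub_distrib]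
  exact Finset.sum_congr rfl fun j _ => by ring

lemma lap_isHermitian {q : ℕ} {d : Fin q → Fin q → ℝ} (hs : ∀ i j, d i j = d j i) :
    (lap d).IsHermitian := by
  ext i j
  by_cases h : i = j
  · subst h; simp [lap]
  · simp [lap, h, Ne.symm h, hs i j]

/-- Summation by parts for symmetric weights. -/
lemma sum_mul_weighted_sub {q : ℕ} {d : Fin q → Fin q → ℝ} (hs : ∀ i j, d i j = d j i)
    (z : Fin q → ℝ) :
    2 * ∑ i, z i * ∑ j, d i j * (z i - z j) = ∑ i, ∑ j, d i j * (z i - z j) ^ 2 := by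
  have h1 : ∑ i, z i * ∑ j, d i j * (z i - z j) = ∑ i, ∑ j, d i j * (z i * (z i - z j)) := by
    simp_rw [Finset.mul_sum]
    exact Finset.sum_congr rfl fun i _ => Finset.sum_congr rfl fun j _ => by ring
  have h2 : ∑ i, ∑ j, d i j * (z i * (z i - z j)) = ∑ i, ∑ j, d i j * (z j * (z j - z i)) := by
    rw [Finset.sum_comm]
    exact Finset.sum_congr rfl fun i _ => Finset.sum_congr rfl fun j _ => by rw [hs]
  rw [two_mul, h1]
  conv_lhs => rw [h2]
  nth_rewrite 2 [← h2]
  rw [← Finset.sum_add_distrib]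
  refine Finset.sum_congr rfl fun i _ => ?_
  rw [← Finset.sum_add_distrib]
  exact Finset.sum_congr rfl fun j _ => by ring

lemma lap_posSemidef {q : ℕ} {d : Fin q → Fin q → ℝ} (h0 : ∀ i j, 0 ≤ d i j)
    (hs : ∀ i j, d i j = d j i) (hd : ∀ i, d i i = 0) : (lap d).PosSemidef := by
  refine .of_dotProduct_mulVec_nonneg (lap_isHermitian hs) fun z => ?_
  have h := sum_mul_weighted_sub hs z
  have h' : star z ⬝ᵥ lap d *ᵥ z = ∑ i, z i * ∑ j, d i j * (z i - z j) := by
    simp [dotProduct, lap_mulVec_apply hd]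
  rw [h']
  have : 0 ≤ ∑ i, ∑ j, d i j * (z i - z j) ^ 2 :=
    Finset.sum_nonneg fun i _ => Finset.sum_nonneg fun j _ => mul_nonneg (h0 i j) (sq_nonneg _)
  linarith

/-- The second smallest element of a multiset of nonnegative reals is positive iff zero occurs at
most once. -/
lemma sort_getD_one_pos_iff (s : Multiset ℝ) (hs : ∀ x ∈ s, 0 ≤ x) (hc : 2 ≤ s.card) :
    0 < (s.sort (· ≤ ·)).getD 1 0 ↔ s.count 0 ≤ 1 := by
  have hsort := s.pairwise_sort (· ≤ ·)
  have heq := s.sort_eq (· ≤ ·)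
  generalize s.sort (· ≤ ·) = l at hsort heq
  subst heq
  match l with
  -- Lists shorter than two are excluded by `hc`, so the default value of `getD` is never read.
  | [] => simp at hc
  | [a] => simp at hc
  | a :: b :: t =>
    simp only [List.pairwise_cons, List.mem_cons, forall_eq_or_imp] at hsort
    simp only [Multiset.mem_coe, List.mem_cons, forall_eq_or_imp] at hs
    simp only [List.getD_cons_succ, List.getD_cons_zero, Multiset.coe_count]
    constructor
    · intro hb
      have : List.count 0 (b :: t) = 0 := by
        rw [List.count_eq_zero]
        intro hmem
        rcases List.mem_cons.1 hmem with h | h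
        · exact hb.ne h
        · exact absurd (hsort.2.1 0 h) (not_le.2 hb)
      rw [List.count_cons, this]
      split_ifs <;> simp
    · intro hcount
      by_contra hb
      have hb0 : b = 0 := le_antisymm (not_lt.1 hb) hs.2.1
      have ha0 : a = 0 := le_antisymm (hb0 ▸ hsort.1.1) hs.1
      subst ha0
      rw [hb0] at hcount
      simp at hcount

/-- By the spectral theorem the characteristic polynomial splits over `ℝ`, so taking real parts of
its complex roots loses nothing. -/
lemma roots_charpoly_map_ofReal_map_re {q : ℕ} {L : Matrix (Fin q) (Fin q) ℝ}
    (hL : L.IsHermitian) :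
    ((L.map Complex.ofReal).charpoly.roots.map Complex.re) =
      Finset.univ.val.map hL.eigenvalues := by
  have h1 : (L.map Complex.ofReal).charpoly = L.charpoly.map (algebraMap ℝ ℂ) :=
    Matrix.charpoly_map L (algebraMap ℝ ℂ)
  have h2 : L.charpoly = ((Finset.univ.val.map hL.eigenvalues).map
      (fun a => Polynomial.X - Polynomial.C a)).prod := by
    rw [hL.charpoly_eq, Multiset.map_map]
    rfl
  rw [h1, h2, Polynomial.map_multiset_prod, Multiset.map_map]
  have h3 : (Finset.univ.val.map hL.eigenvalues).map
      ((Polynomial.map (algebraMap ℝ ℂ)) ∘ fun a => Polynomial.X - Polynomial.C a) =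
      ((Finset.univ.val.map hL.eigenvalues).map (algebraMap ℝ ℂ)).map
        (fun a => Polynomial.X - Polynomial.C a) := by
    rw [Multiset.map_map _ (algebraMap ℝ ℂ)]
    exact Multiset.map_congr rfl fun a _ => by simp
  rw [h3, Polynomial.roots_multiset_prod_X_sub_C, Multiset.map_map]
  exact (Multiset.map_congr rfl fun a _ => by simp).trans (Multiset.map_id _)

/-- Rank-nullity, as the rank of a symmetric matrix counts its nonzero eigenvalues. -/
lemma count_eigenvalues_zero {q : ℕ} {L : Matrix (Fin q) (Fin q) ℝ} (hL : L.IsHermitian) :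
    (Finset.univ.val.map hL.eigenvalues).count 0 =
      Module.finrank ℝ (LinearMap.ker L.mulVecLin) := by
  have h1 := LinearMap.finrank_range_add_finrank_ker L.mulVecLin
  have h2 := hL.rank_eq_card_non_zero_eigs
  rw [Matrix.rank] at h2
  rw [Module.finrank_fin_fun, h2, Fintype.card_subtype] at h1
  have h3 := Finset.card_filter_add_card_filter_not (s := (Finset.univ : Finset (Fin q)))
    (fun i => hL.eigenvalues i ≠ 0)
  rw [Finset.card_univ, Fintype.card_fin] at h3
  rw [Multiset.count_map]
  have h4 : (Multiset.filter (fun a => 0 = hL.eigenvalues a) Finset.univ.val).card =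
      (Finset.univ.filter fun i => ¬ hL.eigenvalues i ≠ 0).card := by
    rw [← Finset.filter_val, Finset.card_val]
    congr 1
    ext i
    simp [eq_comm]
  omega

/-- The second smallest eigenvalue of a Laplacian is positive iff its kernel consists of the
constant vectors. -/
lemma reEigenvalue_lap_two_pos_iff {q : ℕ} (hq : 2 ≤ q) {d : Fin q → Fin q → ℝ}
    (h0 : ∀ i j, 0 ≤ d i j) (hs : ∀ i j, d i j = d j i) (hd : ∀ i, d i i = 0) :
    0 < reEigenvalue ((lap d).map Complex.ofReal) 2 ↔
      ∀ z : Fin q → ℝ, lap d *ᵥ z = 0 → ∀ i j, z i = z j := by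
  have hL := lap_isHermitian hs
  have h1 : lap d *ᵥ (fun _ => 1) = 0 := by
    ext i; rw [lap_mulVec_apply hd]; simp
  rw [reEigenvalue, roots_charpoly_map_ofReal_map_re hL, sort_getD_one_pos_iff,
    count_eigenvalues_zero hL]
  · constructor
    · intro h z hz i j
      obtain ⟨v, hv⟩ := finrank_le_one_iff.1 h
      obtain ⟨a, ha⟩ := hv ⟨z, by simpa using hz⟩
      obtain ⟨b, hb⟩ := hv ⟨fun _ => 1, by simpa using h1⟩
      have ha' : ∀ k, a * v.1 k = z k := fun k => congrFun (congrArg Subtype.val ha) k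
      have hb' : ∀ k, b * v.1 k = 1 := fun k => congrFun (congrArg Subtype.val hb) k
      have hb0 : b ≠ 0 := by
        rintro rfl
        simpa using hb' i
      have : v.1 i = v.1 j := mul_left_cancel₀ hb0 ((hb' i).trans (hb' j).symm)
      rw [← ha', ← ha', this]
    · intro h
      refine finrank_le_one ⟨fun _ => 1, by simpa using h1⟩ fun w => ⟨w.1 ⟨0, by omega⟩, ?_⟩
      ext k
      simpa using h w.1 (LinearMap.mem_ker.1 w.2) _ k
  · intro x hx
    obtain ⟨i, -, rfl⟩ := Multiset.mem_map.1 hx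
    exact (lap_posSemidef h0 hs hd).eigenvalues_nonneg i
  · simpa using hq

/-! ### Linear flows and LaSalle's principle -/

/-- `w` is a trajectory on `[0, ∞)` of the linear vector field `A`. -/
def IsFieldTrajectory {E : Type*} [NormedAddCommGroup E] [NormedSpace ℝ E] (A : E →L[ℝ] E)
    (w : ℝ → E) : Prop :=
  ∀ t : ℝ, 0 ≤ t → HasDerivWithinAt w (A (w t)) (Set.Ici 0) t

section Flow

variable {E : Type*} [NormedAddCommGroup E] [NormedSpace ℝ E] {A : E →L[ℝ] E} {w : ℝ → E}

lemma isFieldTrajectory_exp [CompleteSpace E] (A : E →L[ℝ] E) (z : E) :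
    IsFieldTrajectory A fun t => NormedSpace.exp (t • A) z := fun t _ => by
  have h := (hasDerivAt_exp_smul_const' (𝕂 := ℝ) A t).clm_apply (hasDerivAt_const t z)
  simpa using h.hasDerivWithinAt

lemma IsFieldTrajectory.shift (hw : IsFieldTrajectory A w) {s : ℝ} (hs : 0 ≤ s) :
    IsFieldTrajectory A fun t => w (t + s) := fun t ht => by
  have h := (hw (t + s) (add_nonneg ht hs)).scomp t
    (((hasDerivAt_id t).add_const s).hasDerivWithinAt (s := Set.Ici 0))
    (fun r hr => add_nonneg hr hs)
  simpa [Function.comp_def] using h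

lemma IsFieldTrajectory.continuousOn (hw : IsFieldTrajectory A w) :
    ContinuousOn w (Set.Ici 0) := fun t ht => (hw t ht).continuousWithinAt

/-- Uniqueness makes the time-`t` flow a continuous map, which LaSalle's argument needs in order to
pass to limit points. -/
lemma IsFieldTrajectory.eq_exp [CompleteSpace E] (hw : IsFieldTrajectory A w) {t : ℝ}
    (ht : 0 ≤ t) : w t = NormedSpace.exp (t • A) (w 0) := by
  have hg := isFieldTrajectory_exp A (w 0)
  refine ODE_solution_unique (v := fun _ => A) (a := 0) (b := t) (fun _ => A.lipschitz)
    (hw.continuousOn.mono Set.Icc_subset_Ici_self)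
    (fun s hs => (hw s hs.1).mono (Set.Ici_subset_Ici.2 hs.1))
    (hg.continuousOn.mono Set.Icc_subset_Ici_self)
    (fun s hs => (hg s hs.1).mono (Set.Ici_subset_Ici.2 hs.1)) (by simp) ⟨ht, le_rfl⟩

/-- LaSalle's invariance principle for a linear vector field. -/
lemma IsFieldTrajectory.tendsto_zero_of_lyapunov {F : Type*} [NormedAddCommGroup F]
    [FiniteDimensional ℝ E] (V : E → ℝ) (hVc : Continuous V) (hV0 : ∀ z, 0 ≤ V z)
    (hVb : ∀ c, Bornology.IsBounded {z | V z ≤ c})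
    (hanti : ∀ w : ℝ → E, IsFieldTrajectory A w → AntitoneOn (fun t => V (w t)) (Set.Ici 0))
    (L : E → F) (hL : Continuous L)
    (hinv : ∀ w : ℝ → E, IsFieldTrajectory A w → (∀ t, 0 ≤ t → V (w t) = V (w 0)) → L (w 0) = 0)
    (hw : IsFieldTrajectory A w) : Filter.Tendsto (fun t => L (w t)) Filter.atTop (nhds 0) := by
  have : ProperSpace E := FiniteDimensional.proper ℝ E
  have : CompleteSpace E := FiniteDimensional.complete ℝ E
  obtain ⟨c, hc⟩ : ∃ c, Filter.Tendsto (fun t => V (w t)) Filter.atTop (nhds c) := by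
    have h1 : Antitone fun t => V (w (max t 0)) := fun s t hst =>
      hanti w hw (Set.mem_Ici.2 (le_max_right _ _)) (Set.mem_Ici.2 (le_max_right _ _))
      (max_le_max_right 0 hst)
    refine ⟨_, (tendsto_atTop_ciInf h1 ⟨0, ?_⟩).congr' ?_⟩
    · rintro _ ⟨t, rfl⟩; exact hV0 _
    · filter_upwards [Filter.eventually_ge_atTop 0] with t ht
      rw [max_eq_left ht]
  rw [Filter.tendsto_iff_ultrafilter]
  intro U hU
  have hcomp : IsCompact {z | V z ≤ V (w 0)} :=
    Metric.isCompact_of_isClosed_isBounded (isClosed_le hVc continuous_const) (hVb _)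
  have hmem : ∀ᶠ t in (U : Filter ℝ), w t ∈ {z | V z ≤ V (w 0)} := by
    refine hU ?_
    filter_upwards [Filter.eventually_ge_atTop 0] with t ht
    exact hanti w hw Set.self_mem_Ici ht ht
  obtain ⟨z, -, hz⟩ := hcomp.ultrafilter_le_nhds (U.map w) (Filter.le_principal_iff.2 hmem)
  replace hz : Filter.Tendsto w U (nhds z) := hz
  -- Along `U`, `V (exp (τ A) (w t)) = V (w (τ + t))` tends both to the value at the limit point `z`
  -- and to `c`. So `V` is constant on the orbit of `z`.
  have hVz : ∀ τ : ℝ, 0 ≤ τ → V (NormedSpace.exp (τ • A) z) = c := by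
    intro τ hτ
    have h1 : Filter.Tendsto (fun t => V (NormedSpace.exp (τ • A) (w t))) U
        (nhds (V (NormedSpace.exp (τ • A) z))) :=
      ((hVc.comp (NormedSpace.exp (τ • A)).continuous).tendsto z).comp hz
    have h2 : Filter.Tendsto (fun t => V (w (τ + t))) U (nhds c) :=
      (hc.comp (Filter.tendsto_atTop_add_const_left _ τ Filter.tendsto_id)).mono_left hU
    refine tendsto_nhds_unique (h1.congr' (hU ?_)) h2
    filter_upwards [Filter.eventually_ge_atTop 0] with t ht
    rw [(hw.shift ht).eq_exp hτ, zero_add]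
  have hLz : L z = 0 := by
    have h := hinv _ (isFieldTrajectory_exp A z) fun t ht => by rw [hVz t ht, hVz 0 le_rfl]
    simpa using h
  exact hLz ▸ (hL.tendsto z).comp hz

end Flow

/-- A continuous, positive definite, quadratically homogeneous function has bounded sublevel
sets. -/
lemma isBounded_sublevel_of_homogeneous {E : Type*} [NormedAddCommGroup E] [NormedSpace ℝ E]
    [FiniteDimensional ℝ E] {V : E → ℝ} (hVc : Continuous V) (hVpos : ∀ z, z ≠ 0 → 0 < V z)
    (hVh : ∀ (a : ℝ) z, V (a • z) = a ^ 2 * V z) (c : ℝ) :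
    Bornology.IsBounded {z | V z ≤ c} := by
  have : ProperSpace E := FiniteDimensional.proper ℝ E
  have hne : ∀ z : E, z ≠ 0 → ‖z‖⁻¹ • z ∈ Metric.sphere (0 : E) 1 := fun z hz => by
    simp [norm_smul, inv_mul_cancel₀ (norm_ne_zero_iff.2 hz)]
  by_cases hS : (Metric.sphere (0 : E) 1).Nonempty
  · obtain ⟨s, hs, hmin⟩ := (isCompact_sphere (0 : E) 1).exists_isMinOn hS hVc.continuousOn
    have hs0 : s ≠ 0 := by rintro rfl; simp at hs
    have hm := hVpos s hs0
    refine (Metric.isBounded_iff_subset_closedBall 0).2 ⟨max c 0 / V s + 1, fun z hz => ?_⟩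
    rw [mem_closedBall_zero_iff]
    have hle : ‖z‖ ^ 2 * V s ≤ max c 0 := by
      refine le_trans ?_ (le_max_left c 0 |>.trans' hz)
      by_cases hz0 : z = 0
      · subst hz0
        have := hVh 0 0
        simp at this
        simp [this]
      · have h1 := hmin (hne z hz0)
        simp only [Set.mem_ofPred_eq, hVh] at h1
        calc ‖z‖ ^ 2 * V s ≤ ‖z‖ ^ 2 * (‖z‖⁻¹ ^ 2 * V z) := by gcongr
          _ = V z := by field_simp [norm_ne_zero_iff.2 hz0]
    have h2 : ‖z‖ ^ 2 ≤ max c 0 / V s := (le_div_iff₀ hm).2 hle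
    -- From `r ^ 2 ≤ a` and `2 r ≤ r ^ 2 + 1` follows `r ≤ a + 1`.
    nlinarith [sq_nonneg (‖z‖ - 1), norm_nonneg z]
  · refine (Bornology.isBounded_singleton (x := (0 : E))).subset fun z _ => ?_
    by_contra hz
    exact hS ⟨_, hne z hz⟩

/-! ### Energy balance and sufficiency -/

/-- The vector field of a dissipatively coupled array on pairs (positions, velocities). -/
noncomputable def arrayField {q n : ℕ} (M K : Matrix (Fin n) (Fin n) ℝ)
    (D : Fin q → Fin q → Matrix (Fin n) (Fin n) ℝ) :
    ((Fin q → Fin n → ℝ) × (Fin q → Fin n → ℝ)) →L[ℝ]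
      ((Fin q → Fin n → ℝ) × (Fin q → Fin n → ℝ)) :=
  LinearMap.toContinuousLinearMap
    { toFun := fun z =>
        (z.2, fun i => -(M⁻¹ *ᵥ (K *ᵥ z.1 i + ∑ j, D i j *ᵥ (z.2 i - z.2 j))))
      map_add' := fun y z => by
        refine Prod.ext rfl (funext fun i => ?_)
        simp only [Prod.fst_add, Prod.snd_add, Pi.add_apply, add_sub_add_comm, Matrix.mulVec_add,
          Finset.sum_add_distrib]
        abel
      map_smul' := fun c z => by
        refine Prod.ext rfl (funext fun i => ?_)
        simp only [Prod.smul_fst, Prod.smul_snd, Pi.smul_apply, ← smul_sub, Matrix.mulVec_smul,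
          ← Finset.smul_sum, ← smul_add, ← smul_neg, RingHom.id_apply] }

lemma arrayField_apply {q n : ℕ} (M K : Matrix (Fin n) (Fin n) ℝ)
    (D : Fin q → Fin q → Matrix (Fin n) (Fin n) ℝ)
    (z : (Fin q → Fin n → ℝ) × (Fin q → Fin n → ℝ)) :
    arrayField M K D z =
      (z.2, fun i => -(M⁻¹ *ᵥ (K *ᵥ z.1 i + ∑ j, D i j *ᵥ (z.2 i - z.2 j)))) := rfl

lemma IsArraySolution.exists_isFieldTrajectory {q n : ℕ} {M K : Matrix (Fin n) (Fin n) ℝ}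
    (hM : M.PosDef) {D : Fin q → Fin q → Matrix (Fin n) (Fin n) ℝ} {x : ℝ → Fin q → Fin n → ℝ}
    (hx : IsArraySolution M K D x) :
    ∃ w, IsFieldTrajectory (arrayField M K D) w ∧ ∀ t, (w t).1 = x t := by
  obtain ⟨v, a, h⟩ := hx
  refine ⟨fun t => (x t, v t), fun t ht => ?_, fun t => rfl⟩
  obtain ⟨hx, hv, he⟩ := h t ht
  have ha : a t = fun i => -(M⁻¹ *ᵥ (K *ᵥ x t i + ∑ j, D i j *ᵥ (v t i - v t j))) := by
    funext i
    have h1 := he i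
    rw [add_assoc, add_comm] at h1
    rw [eq_neg_of_add_eq_zero_left h1, Matrix.mulVec_neg, neg_neg, Matrix.mulVec_mulVec,
      Matrix.nonsing_inv_mul _ hM.det_pos.ne'.isUnit, Matrix.one_mulVec]
  rw [arrayField_apply, ← ha]
  exact hx.prodMk hv

lemma HasDerivWithinAt.dotProduct_mulVec_self {n : ℕ} {B : Matrix (Fin n) (Fin n) ℝ}
    (hB : B.IsHermitian) {f : ℝ → Fin n → ℝ} {f' : Fin n → ℝ} {s : Set ℝ} {t : ℝ}
    (h : HasDerivWithinAt f f' s t) :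
    HasDerivWithinAt (fun t => f t ⬝ᵥ B *ᵥ f t) (2 * (f t ⬝ᵥ B *ᵥ f')) s t := by
  have hBs : Bᵀ = B := by simpa using hB.eq
  have h1 : HasDerivWithinAt (fun t => ∑ i, f t i * (B *ᵥ f t) i)
      (∑ i, (f' i * (B *ᵥ f t) i + f t i * (B *ᵥ f') i)) s t :=
    HasDerivWithinAt.fun_sum fun i _ =>
      (hasDerivWithinAt_pi.1 h i).mul (hasDerivWithinAt_pi.1 (h.matrix_mulVec B) i)
  have h2 : ∑ i, (f' i * (B *ᵥ f t) i + f t i * (B *ᵥ f') i) = 2 * (f t ⬝ᵥ B *ᵥ f') := by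
    rw [Finset.sum_add_distrib]
    change f' ⬝ᵥ B *ᵥ f t + f t ⬝ᵥ B *ᵥ f' = _
    rw [Matrix.dotProduct_mulVec, ← Matrix.mulVec_transpose, hBs, dotProduct_comm, two_mul]
  exact h2 ▸ h1

/-- Twice the mechanical energy of an array state. -/
def arrayEnergy {q n : ℕ} (M K : Matrix (Fin n) (Fin n) ℝ)
    (z : (Fin q → Fin n → ℝ) × (Fin q → Fin n → ℝ)) : ℝ :=
  ∑ i, (z.2 i ⬝ᵥ M *ᵥ z.2 i + z.1 i ⬝ᵥ K *ᵥ z.1 i)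

lemma continuous_arrayEnergy {q n : ℕ} (M K : Matrix (Fin n) (Fin n) ℝ) :
    Continuous (arrayEnergy (q := q) M K) := by
  unfold arrayEnergy
  fun_prop

lemma arrayEnergy_smul {q n : ℕ} (M K : Matrix (Fin n) (Fin n) ℝ) (c : ℝ)
    (z : (Fin q → Fin n → ℝ) × (Fin q → Fin n → ℝ)) :
    arrayEnergy M K (c • z) = c ^ 2 * arrayEnergy M K z := by
  simp only [arrayEnergy, Prod.smul_fst, Prod.smul_snd, Pi.smul_apply, Matrix.mulVec_smul,
    smul_dotProduct, dotProduct_smul, smul_eq_mul, Finset.mul_sum]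
  exact Finset.sum_congr rfl fun i _ => by ring

lemma arrayEnergy_pos {q n : ℕ} {M K : Matrix (Fin n) (Fin n) ℝ} (hM : M.PosDef) (hK : K.PosDef)
    {z : (Fin q → Fin n → ℝ) × (Fin q → Fin n → ℝ)} (hz : z ≠ 0) : 0 < arrayEnergy M K z := by
  have h1 : ∀ y, 0 ≤ y ⬝ᵥ M *ᵥ y := fun y => by
    simpa using hM.posSemidef.dotProduct_mulVec_nonneg y
  have h2 : ∀ y, 0 ≤ y ⬝ᵥ K *ᵥ y := fun y => by
    simpa using hK.posSemidef.dotProduct_mulVec_nonneg y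
  have hnn : ∀ i ∈ Finset.univ, 0 ≤ z.2 i ⬝ᵥ M *ᵥ z.2 i + z.1 i ⬝ᵥ K *ᵥ z.1 i :=
    fun i _ => add_nonneg (h1 _) (h2 _)
  refine (Finset.sum_nonneg hnn).lt_of_ne fun h0 => hz ?_
  have h := (Finset.sum_eq_zero_iff_of_nonneg hnn).1 h0.symm
  refine Prod.ext (funext fun i => ?_) (funext fun i => ?_)
  · by_contra hi
    have h3 := hK.dotProduct_mulVec_pos hi
    simp only [star_trivial] at h3
    have := h i (Finset.mem_univ i)
    linarith [h1 (z.2 i)]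
  · by_contra hi
    have h3 := hM.dotProduct_mulVec_pos hi
    simp only [star_trivial] at h3
    have := h i (Finset.mem_univ i)
    linarith [h2 (z.1 i)]

lemma arrayEnergy_nonneg {q n : ℕ} {M K : Matrix (Fin n) (Fin n) ℝ} (hM : M.PosDef)
    (hK : K.PosDef) (z : (Fin q → Fin n → ℝ) × (Fin q → Fin n → ℝ)) : 0 ≤ arrayEnergy M K z := by
  by_cases hz : z = 0
  · subst hz; simp [arrayEnergy]
  · exact (arrayEnergy_pos hM hK hz).le

/-- The power dissipated by a Laplacian output coupling. -/
def arrayDissipation {q n m : ℕ} (C : Matrix (Fin m) (Fin n) ℝ) (d : Fin q → Fin q → ℝ)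
    (v : Fin q → Fin n → ℝ) : ℝ :=
  ∑ k, ∑ i, ∑ j, d i j * ((C *ᵥ v i) k - (C *ᵥ v j) k) ^ 2

lemma arrayDissipation_nonneg {q n m : ℕ} (C : Matrix (Fin m) (Fin n) ℝ) {d : Fin q → Fin q → ℝ}
    (h0 : ∀ i j, 0 ≤ d i j) (v : Fin q → Fin n → ℝ) : 0 ≤ arrayDissipation C d v :=
  Finset.sum_nonneg fun _ _ => Finset.sum_nonneg fun i _ => Finset.sum_nonneg fun j _ =>
    mul_nonneg (h0 i j) (sq_nonneg _)

/-- Summation by parts in each output coordinate. The factor 2 agrees with `arrayEnergy` being twice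
the energy. -/
lemma sum_dotProduct_coupling {q n m : ℕ} (C : Matrix (Fin m) (Fin n) ℝ) {d : Fin q → Fin q → ℝ}
    (hs : ∀ i j, d i j = d j i) (v : Fin q → Fin n → ℝ) :
    2 * ∑ i, v i ⬝ᵥ ∑ j, (d i j • (Cᵀ * C)) *ᵥ (v i - v j) = arrayDissipation C d v := by
  have h : ∀ i, v i ⬝ᵥ ∑ j, (d i j • (Cᵀ * C)) *ᵥ (v i - v j) =
      ∑ k, (C *ᵥ v i) k * ∑ j, d i j * ((C *ᵥ v i) k - (C *ᵥ v j) k) := by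
    intro i
    have h1 : ∑ j, (d i j • (Cᵀ * C)) *ᵥ (v i - v j) =
        Cᵀ *ᵥ ∑ j, d i j • (C *ᵥ v i - C *ᵥ v j) := by
      rw [Matrix.mulVec_sum]
      refine Finset.sum_congr rfl fun j _ => ?_
      rw [Matrix.smul_mulVec, Matrix.mulVec_smul, ← Matrix.mulVec_sub, Matrix.mulVec_mulVec]
    rw [h1, Matrix.dotProduct_mulVec, Matrix.vecMul_transpose]
    simp [dotProduct, Finset.sum_apply]
  rw [Finset.sum_congr rfl fun i _ => h i, Finset.sum_comm, Finset.mul_sum]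
  exact Finset.sum_congr rfl fun k _ => sum_mul_weighted_sub hs fun i => (C *ᵥ v i) k

section Trajectory

variable {q n m : ℕ} {M K : Matrix (Fin n) (Fin n) ℝ} {C : Matrix (Fin m) (Fin n) ℝ}
  {d : Fin q → Fin q → ℝ} {w : ℝ → (Fin q → Fin n → ℝ) × (Fin q → Fin n → ℝ)}

lemma IsFieldTrajectory.hasDerivWithinAt_fst {D : Fin q → Fin q → Matrix (Fin n) (Fin n) ℝ}
    (hw : IsFieldTrajectory (arrayField M K D) w) {t : ℝ} (ht : 0 ≤ t) (i : Fin q) :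
    HasDerivWithinAt (fun t => (w t).1 i) ((w t).2 i) (Set.Ici 0) t :=
  hasDerivWithinAt_pi.1 ((ContinuousLinearMap.fst ℝ _ _).hasFDerivAt.comp_hasDerivWithinAt t
    (hw t ht)) i

lemma IsFieldTrajectory.hasDerivWithinAt_snd {D : Fin q → Fin q → Matrix (Fin n) (Fin n) ℝ}
    (hw : IsFieldTrajectory (arrayField M K D) w) {t : ℝ} (ht : 0 ≤ t) (i : Fin q) :
    HasDerivWithinAt (fun t => (w t).2 i)
      (-(M⁻¹ *ᵥ (K *ᵥ (w t).1 i + ∑ j, D i j *ᵥ ((w t).2 i - (w t).2 j)))) (Set.Ici 0) t :=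
  hasDerivWithinAt_pi.1 ((ContinuousLinearMap.snd ℝ _ _).hasFDerivAt.comp_hasDerivWithinAt t
    (hw t ht)) i

/-- The energy balance of a dissipatively coupled array. -/
lemma IsFieldTrajectory.hasDerivWithinAt_arrayEnergy (hM : M.PosDef) (hK : K.PosDef)
    (hs : ∀ i j, d i j = d j i)
    (hw : IsFieldTrajectory (arrayField M K fun i j => d i j • (Cᵀ * C)) w) {t : ℝ} (ht : 0 ≤ t) :
    HasDerivWithinAt (fun t => arrayEnergy M K (w t)) (-arrayDissipation C d (w t).2)
      (Set.Ici 0) t := by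
  have h := HasDerivWithinAt.fun_sum (u := Finset.univ) fun (i : Fin q) _ =>
    ((hw.hasDerivWithinAt_snd ht i).dotProduct_mulVec_self hM.isHermitian).add
      ((hw.hasDerivWithinAt_fst ht i).dotProduct_mulVec_self hK.isHermitian)
  refine h.congr_deriv ?_
  rw [← sum_dotProduct_coupling C hs, Finset.mul_sum, ← Finset.sum_neg_distrib]
  refine Finset.sum_congr rfl fun i _ => ?_
  have hKs : Kᵀ = K := by simpa using hK.isHermitian.eq
  have h1 : (w t).1 i ⬝ᵥ K *ᵥ (w t).2 i = (w t).2 i ⬝ᵥ K *ᵥ (w t).1 i := by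
    rw [Matrix.dotProduct_mulVec, ← Matrix.mulVec_transpose, hKs, dotProduct_comm]
  rw [Matrix.mulVec_neg, Matrix.mulVec_mulVec, Matrix.mul_nonsing_inv _ hM.det_pos.ne'.isUnit,
    Matrix.one_mulVec, h1, dotProduct_neg, dotProduct_add]
  ring

lemma IsFieldTrajectory.antitoneOn_arrayEnergy (hM : M.PosDef) (hK : K.PosDef)
    (h0 : ∀ i j, 0 ≤ d i j) (hs : ∀ i j, d i j = d j i)
    (hw : IsFieldTrajectory (arrayField M K fun i j => d i j • (Cᵀ * C)) w) :
    AntitoneOn (fun t => arrayEnergy M K (w t)) (Set.Ici 0) := by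
  have h := fun t ht => hw.hasDerivWithinAt_arrayEnergy (t := t) hM hK hs ht
  refine antitoneOn_of_hasDerivWithinAt_nonpos (convex_Ici 0)
    (fun t ht => (h t ht).continuousWithinAt)
    (fun t ht => (h t (interior_subset ht)).mono interior_subset)
    fun t _ => neg_nonpos.2 (arrayDissipation_nonneg C h0 _)

/-- Along a trajectory of constant energy all oscillators coincide. -/
lemma IsFieldTrajectory.fst_eq_of_arrayEnergy_const (hM : M.PosDef) (hK : K.PosDef)
    (h0 : ∀ i j, 0 ≤ d i j) (hs : ∀ i j, d i j = d j i) (hd : ∀ i, d i i = 0)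
    (hker : ∀ z : Fin q → ℝ, lap d *ᵥ z = 0 → ∀ i j, z i = z j)
    (hobs : unobservableSubspace C (M⁻¹ * K) = ⊥)
    (hw : IsFieldTrajectory (arrayField M K fun i j => d i j • (Cᵀ * C)) w)
    (hconst : ∀ t, 0 ≤ t → arrayEnergy M K (w t) = arrayEnergy M K (w 0)) (i j : Fin q) :
    (w 0).1 i - (w 0).1 j = 0 := by
  have hout : ∀ t, 0 ≤ t → ∀ i j, C *ᵥ (w t).2 i = C *ᵥ (w t).2 j := by
    intro t ht
    have hdiss : arrayDissipation C d (w t).2 = 0 :=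
      neg_eq_zero.1 (((hw.hasDerivWithinAt_arrayEnergy hM hK hs ht).sub_const
        (arrayEnergy M K (w 0))).eq_zero_of_eqOn_Ici ht fun s hs => sub_eq_zero.2 (hconst s hs))
    have hterm : ∀ k i j, d i j * ((C *ᵥ (w t).2 i) k - (C *ᵥ (w t).2 j) k) ^ 2 = 0 := by
      intro k i j
      have hn : ∀ k i j, 0 ≤ d i j * ((C *ᵥ (w t).2 i) k - (C *ᵥ (w t).2 j) k) ^ 2 :=
        fun k i j => mul_nonneg (h0 i j) (sq_nonneg _)
      have h1 := (Finset.sum_eq_zero_iff_of_nonneg fun k _ => Finset.sum_nonneg fun i _ =>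
        Finset.sum_nonneg fun j _ => hn k i j).1 hdiss k (Finset.mem_univ k)
      have h2 := (Finset.sum_eq_zero_iff_of_nonneg fun i _ =>
        Finset.sum_nonneg fun j _ => hn k i j).1 h1 i (Finset.mem_univ i)
      exact (Finset.sum_eq_zero_iff_of_nonneg fun j _ => hn k i j).1 h2 j (Finset.mem_univ j)
    intro i j
    ext k
    refine hker (fun i => (C *ᵥ (w t).2 i) k) ?_ i j
    ext i
    rw [lap_mulVec_apply hd]
    refine Finset.sum_eq_zero fun j _ => ?_
    rcases mul_eq_zero.1 (hterm k i j) with h | h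
    · rw [h, zero_mul]
    · rw [pow_eq_zero_iff two_ne_zero] at h
      rw [h, mul_zero]
  have hacc : ∀ t, 0 ≤ t → ∀ i, HasDerivWithinAt (fun t => (w t).2 i)
      (-((M⁻¹ * K) *ᵥ (w t).1 i)) (Set.Ici 0) t := by
    intro t ht i
    have h := hw.hasDerivWithinAt_snd ht i
    rw [Finset.sum_eq_zero, add_zero, Matrix.mulVec_mulVec] at h
    · exact h
    · intro j _
      rw [Matrix.smul_mulVec, ← Matrix.mulVec_mulVec, Matrix.mulVec_sub, hout t ht i j, sub_self,
        Matrix.mulVec_zero, smul_zero]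
  have hacc' : ∀ t, 0 ≤ t → HasDerivWithinAt (fun t => (w t).2 i - (w t).2 j)
      (-((M⁻¹ * K) *ᵥ ((w t).1 i - (w t).1 j))) (Set.Ici 0) t := by
    intro t ht
    refine ((hacc t ht i).sub (hacc t ht j)).congr_deriv ?_
    rw [Matrix.mulVec_sub]
    abel
  -- Each power of `M⁻¹ K` takes two derivatives: the velocity relation gives the next power on
  -- positions, and that one gives it back on velocities.
  have hvel : ∀ k : ℕ, ∀ t, 0 ≤ t → (C * (M⁻¹ * K) ^ k) *ᵥ ((w t).2 i - (w t).2 j) = 0 := by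
    intro k
    induction k with
    | zero =>
      intro t ht
      rw [pow_zero, Matrix.mul_one, Matrix.mulVec_sub, hout t ht i j, sub_self]
    | succ k ih =>
      have hpos : ∀ t, 0 ≤ t → (C * (M⁻¹ * K) ^ (k + 1)) *ᵥ ((w t).1 i - (w t).1 j) = 0 := by
        intro t ht
        have h := ((hacc' t ht).matrix_mulVec (C * (M⁻¹ * K) ^ k)).eq_zero_of_eqOn_Ici ht ih
        rwa [Matrix.mulVec_neg, neg_eq_zero, Matrix.mulVec_mulVec, Matrix.mul_assoc,
          ← pow_succ] at h
      intro t ht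
      exact (((hw.hasDerivWithinAt_fst ht i).sub
        (hw.hasDerivWithinAt_fst ht j)).matrix_mulVec _).eq_zero_of_eqOn_Ici ht hpos
  have hvel0 : ∀ t, 0 ≤ t → (w t).2 i - (w t).2 j = 0 := by
    intro t ht
    have hmem : (w t).2 i - (w t).2 j ∈ unobservableSubspace C (M⁻¹ * K) := fun k => hvel k t ht
    rwa [hobs, Submodule.mem_bot] at hmem
  have hA := neg_eq_zero.1 ((hacc' 0 le_rfl).eq_zero_of_eqOn_Ici le_rfl hvel0)
  by_contra hne
  have hp := hK.dotProduct_mulVec_pos hne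
  rw [← hM.mul_inv_mulVec, hA, Matrix.mulVec_zero, dotProduct_zero] at hp
  exact lt_irrefl _ hp

end Trajectory

lemma synchronizes_of_observable {q n m : ℕ} {M K : Matrix (Fin n) (Fin n) ℝ} (hM : M.PosDef)
    (hK : K.PosDef) {C : Matrix (Fin m) (Fin n) ℝ} {d : Fin q → Fin q → ℝ}
    (h0 : ∀ i j, 0 ≤ d i j) (hs : ∀ i j, d i j = d j i) (hd : ∀ i, d i i = 0)
    (hker : ∀ z : Fin q → ℝ, lap d *ᵥ z = 0 → ∀ i j, z i = z j)
    (hobs : IsObservable C (M⁻¹ * K)) :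
    Synchronizes M K (fun i j => d i j • (Cᵀ * C)) := by
  intro x hx i j
  obtain ⟨w, hw, hwx⟩ := hx.exists_isFieldTrajectory hM
  have hlim : Filter.Tendsto (fun t => (w t).1 i - (w t).1 j) Filter.atTop (nhds 0) :=
    hw.tendsto_zero_of_lyapunov (arrayEnergy M K) (continuous_arrayEnergy M K)
      (arrayEnergy_nonneg hM hK)
      (isBounded_sublevel_of_homogeneous (continuous_arrayEnergy M K)
        (fun z hz => arrayEnergy_pos hM hK hz) (arrayEnergy_smul M K))
      (fun w hw => hw.antitoneOn_arrayEnergy hM hK h0 hs) (fun z => z.1 i - z.1 j)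
      (by fun_prop) fun w hw hc => hw.fst_eq_of_arrayEnergy_const hM hK h0 hs hd hker
        (hobs.unobservableSubspace_eq_bot hM hK) hc i j
  simp only [hwx] at hlim
  have h := ((PiLp.continuous_toLp 2 fun _ : Fin n => ℝ).norm.tendsto 0).comp hlim
  simpa [Function.comp_def] using h

/-! ### Undamped modes and necessity -/

/-- A modal oscillation that the coupling does not see. -/
lemma isArraySolution_cos {q n : ℕ} {M K : Matrix (Fin n) (Fin n) ℝ} (hM : M.PosDef)
    {D : Fin q → Fin q → Matrix (Fin n) (Fin n) ℝ} {u : Fin n → ℝ} {ω : ℝ}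
    (hu : (M⁻¹ * K) *ᵥ u = ω ^ 2 • u) {z : Fin q → ℝ}
    (hD : ∀ i, ∑ j, (z i - z j) • D i j *ᵥ u = 0) :
    IsArraySolution M K D fun t i => (Real.cos (ω * t) * z i) • u := by
  refine ⟨fun t i => (-(Real.sin (ω * t)) * ω * z i) • u,
    fun t i => (-(Real.cos (ω * t) * ω) * ω * z i) • u, fun t _ => ⟨?_, ?_, fun i => ?_⟩⟩
  · refine hasDerivWithinAt_pi.2 fun i => HasDerivAt.hasDerivWithinAt ?_
    refine HasDerivAt.smul_const (HasDerivAt.mul_const ?_ _) _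
    simpa using ((hasDerivAt_id t).const_mul ω).cos
  · refine hasDerivWithinAt_pi.2 fun i => HasDerivAt.hasDerivWithinAt ?_
    refine HasDerivAt.smul_const (HasDerivAt.mul_const (HasDerivAt.mul_const ?_ _) _) _
    have h : HasDerivAt (fun t => Real.sin (ω * t)) (Real.cos (ω * t) * ω) t := by
      simpa using ((hasDerivAt_id t).const_mul ω).sin
    exact h.fun_neg
  · have hKu : K *ᵥ u = ω ^ 2 • M *ᵥ u := by
      rw [← hM.mul_inv_mulVec, hu, Matrix.mulVec_smul]
    have h1 : ∑ j, D i j *ᵥ ((-(Real.sin (ω * t)) * ω * z i) • u -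
        (-(Real.sin (ω * t)) * ω * z j) • u) =
        (-(Real.sin (ω * t)) * ω) • ∑ j, (z i - z j) • D i j *ᵥ u := by
      rw [Finset.smul_sum]
      refine Finset.sum_congr rfl fun j _ => ?_
      rw [← sub_smul, Matrix.mulVec_smul, smul_smul, mul_sub]
    rw [h1, hD, smul_zero, add_zero, Matrix.mulVec_smul, Matrix.mulVec_smul, hKu, smul_smul,
      ← add_smul]
    convert zero_smul ℝ _ using 2
    ring

/-- Sampled at multiples of its period, the mode has the constant difference `(zᵢ - zⱼ) u`, which
must tend to zero. -/
lemma Synchronizes.eq_of_mode {q n : ℕ} {M K : Matrix (Fin n) (Fin n) ℝ} (hM : M.PosDef)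
    {D : Fin q → Fin q → Matrix (Fin n) (Fin n) ℝ} (h : Synchronizes M K D) {u : Fin n → ℝ}
    (hu0 : u ≠ 0) {μ : ℝ} (hμ : 0 < μ) (hu : (M⁻¹ * K) *ᵥ u = μ • u) {z : Fin q → ℝ}
    (hD : ∀ i, ∑ j, (z i - z j) • D i j *ᵥ u = 0) (i j : Fin q) : z i = z j := by
  have hω : 0 < √μ := Real.sqrt_pos.2 hμ
  have hlim := h _ (isArraySolution_cos hM (ω := √μ) (by rwa [Real.sq_sqrt hμ.le]) hD) i j
  have hseq : Filter.Tendsto (fun k : ℕ => (k : ℝ) * (2 * Real.pi / √μ)) Filter.atTop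
      Filter.atTop :=
    tendsto_natCast_atTop_atTop.atTop_mul_const (by positivity)
  have hc := hlim.comp hseq
  have heq : ∀ k : ℕ, √μ * ((k : ℝ) * (2 * Real.pi / √μ)) = k * (2 * Real.pi) := fun k => by
    field_simp
  simp only [Function.comp_def, heq, Real.cos_nat_mul_two_pi, one_mul] at hc
  have hz := tendsto_nhds_unique tendsto_const_nhds hc
  rw [← sub_smul, norm_eq_zero, WithLp.toLp_eq_zero, smul_eq_zero, sub_eq_zero] at hz
  exact hz.resolve_right hu0

theorem mainTheorem5 (q n m : ℕ) (hq : 2 ≤ q) (hn : 1 ≤ n)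
    (M K : Matrix (Fin n) (Fin n) ℝ) (hM : M.PosDef) (hK : K.PosDef)
    (hσ : (pencilPoly M K).roots.Nodup)
    (C : Matrix (Fin m) (Fin n) ℝ) (d : Fin q → Fin q → ℝ)
    (hd_nonneg : ∀ i j, 0 ≤ d i j) (hd_symm : ∀ i j, d i j = d j i) (hd_diag : ∀ i, d i i = 0) :
    Synchronizes M K (fun i j => d i j • (Cᵀ * C)) ↔
      0 < reEigenvalue ((lap d).map Complex.ofReal) 2 ∧ IsObservable C (M⁻¹ * K) := by
  rw [reEigenvalue_lap_two_pos_iff hq hd_nonneg hd_symm hd_diag]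
  refine ⟨fun h => ⟨fun z hz => ?_, ?_⟩, fun ⟨hker, hobs⟩ =>
    synchronizes_of_observable hM hK hd_nonneg hd_symm hd_diag hker hobs⟩
  · have : Nonempty (Fin n) := ⟨⟨0, hn⟩⟩
    obtain ⟨u, -, hu0, μ, hμ, hu⟩ :=
      exists_pencil_eigenvector hM hK ⊤ top_ne_bot fun _ _ => Submodule.mem_top
    refine h.eq_of_mode hM hu0 hμ hu fun i => ?_
    have hi := congrFun hz i
    rw [lap_mulVec_apply hd_diag] at hi
    have : ∀ j, (z i - z j) • (d i j • (Cᵀ * C)) *ᵥ u = (d i j * (z i - z j)) • (Cᵀ * C) *ᵥ u :=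
      fun j => by rw [Matrix.smul_mulVec, smul_smul, mul_comm]
    rw [Finset.sum_congr rfl fun j _ => this j, ← Finset.sum_smul, hi, Pi.zero_apply, zero_smul]
  · by_contra hobs
    have hN : unobservableSubspace C (M⁻¹ * K) ≠ ⊥ := fun hN =>
      hobs (isObservable_of_unobservableSubspace_eq_bot hN)
    obtain ⟨u, huN, hu0, μ, hμ, hu⟩ :=
      exists_pencil_eigenvector hM hK _ hN fun v hv => mulVec_mem_unobservableSubspace hv
    have hCu : C *ᵥ u = 0 := by simpa using huN 0
    -- As `C u = 0`, the amplitudes are free: only the oscillator of index 0 moves, and `2 ≤ q`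
    -- supplies one at rest.
    have h01 := h.eq_of_mode hM hu0 hμ hu (z := fun i => if i.1 = 0 then 1 else 0)
      (fun i => Finset.sum_eq_zero fun j _ => by
        rw [Matrix.smul_mulVec, ← Matrix.mulVec_mulVec, hCu, Matrix.mulVec_zero, smul_zero,
          smul_zero]) ⟨0, by omega⟩ ⟨1, by omega⟩
    simp at h01
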